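/- Let $p_1,\dots,p_m,q_1,\dots,q_m,g_1,\dots,g_r\in\mathbb{R}[x]=\mathbb{R}[x_1,\dots,x_n]$ with $m\ge 1$, let $\Omega=\{x\in\mathbb{R}^n: g_j(x)\ge 0,\ j=1,\dots,r\}$ and $\Delta=[-1,1]^n$. Assume that $\Omega$ is nonempty and compact, that $\Omega\subseteq\Delta$, and that $q_i>0$ on $\Omega$ for all $i$. Let $\lambda$ be the scaled Lebesgue measure $d\lambda(x)=dx/2^n$ on $\Delta$, and let $\Sigma^2[\cdot]$ denote the set of sums of squares of polynomials in the indicated variables. For each $i$ let $f_i^{\mathrm{lower}}, f_i^{\mathrm{upper}}\in\mathbb{R}$ be such that each of the polynomials $p_i-f_i^{\mathrm{lower}}q_i$ and $f_i^{\mathrm{upper}}q_i-p_i$ is of the form $\sigma_0+\sum_{j=1}^r\sigma_jg_j+\sum_{j=1}^n\sigma_{r+j}(1-x_j^2)$ with $\sigma_0,\sigma_j\in\Sigma^2[x]$ and all terms $\sigma_0$, $\sigma_jg_j$, $\sigma_{r+j}(1-x_j^2)$ of degree at most $2k_i$, for some $k_i\in\mathbb{N}$ (which may differ for the two polynomials).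 Put $f^{\mathrm{lower}}=\min_i f_i^{\mathrm{lower}}$, $f^{\mathrm{upper}}=\max_i f_i^{\mathrm{upper}}$ and $M=f^{\mathrm{upper}}-f^{\mathrm{lower}}$. For $x\in\Delta$ let $$\mathbf{K}_x=\{(y,z)\in\Omega\times[-M,M]:\ p_i(x)q_i(y)-p_i(y)q_i(x)-z\,q_i(x)q_i(y)\ge 0,\ i=1,\dots,m\},\qquad \tilde\psi(x)=\max_{(y,z)\in\mathbf{K}_x}z .$$ Assume that $\mathbf{K}_x\ne\emptyset$ for every $x\in\Delta$, so that $\tilde\psi$ is a well-defined real function on $\Delta$. In $\mathbb{R}[x,y,z]$, with $y=(y_1,\dots,y_n)$ and a single variable $z$, consider four blocks of polynomials: block 1 consists of $p_i(x)q_i(y)-p_i(y)q_i(x)-z\,q_i(x)q_i(y)$ $(i=1,\dots,m)$ and $2n+M^2-\sum_{j=1}^n(x_j^2+y_j^2)-z^2$; block 2 of $g_1(y),\dots,g_r(y),1-y_1^2,\dots,1-y_n^2$; block 3 of $1-x_1^2,\dots,1-x_n^2$; block 4 of $M^2-z^2$. Write $h_{i,j}$, $j\in J_i$, for the polynomials of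 block $i$, and let $I_1=\{x,y,z\}$, $I_2=\{y\}$, $I_3=\{x\}$, $I_4=\{z\}$. For $k\ge k_0:=\max_{i,j}\lceil\deg(h_{i,j})/2\rceil$ consider the sparse relaxation $$(\mathrm{SP}_k)\qquad \tilde\rho_k^*=\inf\int_\Delta\phi\,d\lambda\quad\text{s.t.}\quad \phi\in\mathbb{R}[x],\ \deg\phi\le 2k,\quad \phi(x)-z=\sum_{i=1}^4\Big(\sigma_{i,0}+\sum_{j\in J_i}\sigma_{i,j}h_{i,j}\Big),$$ $$\sigma_{i,0},\sigma_{i,j}\in\Sigma^2[I_i],\qquad \deg(\sigma_{i,0})\le 2k,\ \deg(\sigma_{i,j}h_{i,j})\le 2k\quad(i=1,\dots,4,\ j\in J_i).$$ Then $\tilde\psi$ is $\lambda$-integrable and $\lim_{k\to\infty}\tilde\rho_k^*=\int_\Delta\tilde\psi\,d\lambda$. Moreover, if $(\varepsilon_k)$ is a real sequence with $\varepsilon_k\to 0$ (for example $\varepsilon_k=1/k$) and if, for every $k\ge k_0$, $\psi_k$ is feasible for $(\mathrm{SP}_k)$ (with some multipliers) and $\int_\Delta\psi_k\,d\lambda\le\tilde\rho_k^*+\varepsilon_k$,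 then $\psi_k\ge\tilde\psi$ on $\Delta$ for every $k\ge k_0$, and $$\lim_{k\to\infty}\int_\Delta|\psi_k-\tilde\psi|\,d\lambda=0 .$$ -/

import Mathlib

open MeasureTheory Filter Topology MvPolynomial

noncomputable section

/-- `Σ²[I]`: the polynomials that are sums of squares in the ring `ℝ[I]` of polynomials in the
variables belonging to `I`. -/
def IsSOSIn {τ : Type*} (I : Set τ) (f : MvPolynomial τ ℝ) : Prop :=
  ∃ s : MvPolynomial.supported ℝ I, IsSumSq s ∧ (s : MvPolynomial τ ℝ) = f

/-- The polynomials `σ₀ + ∑ⱼ σⱼ hⱼ` with `σ₀, σⱼ ∈ Σ²[I]`, `deg σ₀ ≤ d` and `deg (σⱼ hⱼ) ≤ d`. -/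
def truncQuadModule {τ ι : Type*} [Fintype ι] (I : Set τ) (h : ι → MvPolynomial τ ℝ) (d : ℕ) :
    Set (MvPolynomial τ ℝ) :=
  {f | ∃ (σ₀ : MvPolynomial τ ℝ) (σ : ι → MvPolynomial τ ℝ),
    IsSOSIn I σ₀ ∧ (∀ j, IsSOSIn I (σ j)) ∧
    σ₀.totalDegree ≤ d ∧ (∀ j, (σ j * h j).totalDegree ≤ d) ∧
    f = σ₀ + ∑ j, σ j * h j}

/-- The cube `Δ = [-1, 1]ⁿ`. -/
def cube (n : ℕ) : Set (Fin n → ℝ) := Set.Icc (fun _ => -1) (fun _ => 1)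

/-- The scaled Lebesgue measure `dx / 2ⁿ` on the cube `Δ`. -/
def cubeMeasure (n : ℕ) : Measure (Fin n → ℝ) :=
  ((2 : ENNReal) ^ n)⁻¹ • (volume.restrict (cube n))

/-- The variables `(x, y, z)`, with `x` and `y` consisting of `n` real variables each and `z` of
one. -/
abbrev Var (n : ℕ) : Type := Fin n ⊕ Fin n ⊕ Unit

/-- The variable `x_j`. -/
abbrev Var.x {n : ℕ} (j : Fin n) : Var n := Sum.inl j

/-- The variable `y_j`. -/
abbrev Var.y {n : ℕ} (j : Fin n) : Var n := Sum.inr (Sum.inl j)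

/-- The variable `z`. -/
abbrev Var.z {n : ℕ} : Var n := Sum.inr (Sum.inr ())

/-- The polynomial `f(x)`, as an element of `ℝ[x, y, z]`. -/
abbrev inX {n : ℕ} (f : MvPolynomial (Fin n) ℝ) : MvPolynomial (Var n) ℝ := rename Var.x f

/-- The polynomial `f(y)`, as an element of `ℝ[x, y, z]`. -/
abbrev inY {n : ℕ} (f : MvPolynomial (Fin n) ℝ) : MvPolynomial (Var n) ℝ := rename Var.y f

/-- The data of a vector rational optimization problem: minimize
`(p₁ / q₁, …, p_m / q_m)` subject to `g₁ ≥ 0, …, g_r ≥ 0` over `ℝⁿ`. -/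
structure VROP (n m r : ℕ) where
  p : Fin m → MvPolynomial (Fin n) ℝ
  q : Fin m → MvPolynomial (Fin n) ℝ
  g : Fin r → MvPolynomial (Fin n) ℝ

namespace VROP

/-- The feasible set `Ω`. -/
def feasibleSet {n m r : ℕ} (P : VROP n m r) : Set (Fin n → ℝ) :=
  {x | ∀ j, 0 ≤ eval x (P.g j)}

/-- The polynomials `g₁, …, g_r, 1 - x₁², …, 1 - x_n²` in `ℝ[x]`. -/
def gBox {n m r : ℕ} (P : VROP n m r) : Fin r ⊕ Fin n → MvPolynomial (Fin n) ℝ :=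
  Sum.elim P.g (fun j => 1 - X j ^ 2)

/-- `a i` is a certified lower bound of `p i / q i`: the polynomial `p i - a i • q i` has a
sum-of-squares representation of some order `k` with respect to the `g_j` and the `1 - x_j²`. -/
def IsCertLower {n m r : ℕ} (P : VROP n m r) (a : Fin m → ℝ) : Prop :=
  ∀ i, ∃ k : ℕ, P.p i - C (a i) * P.q i ∈ truncQuadModule Set.univ P.gBox (2 * k)

/-- `b i` is a certified upper bound of `p i / q i`. -/
def IsCertUpper {n m r : ℕ} (P : VROP n m r) (b : Fin m → ℝ) : Prop :=
  ∀ i, ∃ k : ℕ, C (b i) * P.q i - P.p i ∈ truncQuadModule Set.univ P.gBox (2 * k)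

/-- The set `K` of all `(x, y, z)` with `x ∈ Δ`, `y ∈ Ω`, `z ∈ [fl - fu, fu - fl]` and
`p_i(x) q_i(y) - p_i(y) q_i(x) - z q_i(x) q_i(y) ≥ 0` for all `i`. -/
def setK {n m r : ℕ} (P : VROP n m r) (fl fu : ℝ) : Set ((Fin n → ℝ) × (Fin n → ℝ) × ℝ) :=
  {w | (∀ i, 0 ≤ eval w.1 (P.p i) * eval w.2.1 (P.q i) - eval w.2.1 (P.p i) * eval w.1 (P.q i)
        - w.2.2 * eval w.1 (P.q i) * eval w.2.1 (P.q i)) ∧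
      w.1 ∈ cube n ∧ w.2.1 ∈ P.feasibleSet ∧ w.2.2 ∈ Set.Icc (fl - fu) (fu - fl)}

/-- The fibre `K_x`. -/
def fibreK {n m r : ℕ} (P : VROP n m r) (fl fu : ℝ) (x : Fin n → ℝ) : Set ((Fin n → ℝ) × ℝ) :=
  {w | (x, w.1, w.2) ∈ P.setK fl fu}

/-- The function `ψ̃(x) = max {z : (y, z) ∈ K_x}`. -/
def psiTilde {n m r : ℕ} (P : VROP n m r) (fl fu : ℝ) (x : Fin n → ℝ) : ℝ :=
  sSup (Prod.snd '' P.fibreK fl fu x)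

/-- First block, in the variables `x, y, z`: the `m` polynomials
`p_i(x) q_i(y) - p_i(y) q_i(x) - z q_i(x) q_i(y)` and the redundant polynomial
`2n + (fu - fl)² - ∑ (x_j² + y_j²) - z²`. -/
def h₁ {n m r : ℕ} (P : VROP n m r) (fl fu : ℝ) : Fin m ⊕ Unit → MvPolynomial (Var n) ℝ :=
  Sum.elim
    (fun i => inX (P.p i) * inY (P.q i) - inY (P.p i) * inX (P.q i)
      - X Var.z * inX (P.q i) * inY (P.q i))
    (fun _ => C (2 * (n : ℝ) + (fu - fl) ^ 2)
      - ∑ j : Fin n, (X (Var.x j) ^ 2 + X (Var.y j) ^ 2) - X Var.z ^ 2)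

/-- Second block, in the variables `y`: the polynomials `g_j(y)` and `1 - y_j²`. -/
def h₂ {n m r : ℕ} (P : VROP n m r) : Fin r ⊕ Fin n → MvPolynomial (Var n) ℝ :=
  Sum.elim (fun j => inY (P.g j)) (fun j => 1 - X (Var.y j) ^ 2)

/-- Third block, in the variables `x`: the polynomials `1 - x_j²`. -/
def h₃ (n : ℕ) : Fin n → MvPolynomial (Var n) ℝ := fun j => 1 - X (Var.x j) ^ 2

/-- Fourth block, in the variable `z`: the polynomial `(fu - fl)² - z²`. -/
def h₄ (n : ℕ) (fl fu : ℝ) : Unit → MvPolynomial (Var n) ℝ :=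
  fun _ => C ((fu - fl) ^ 2) - X Var.z ^ 2

/-- The least admissible relaxation order: the maximum of `⌈deg h / 2⌉` over all the constraint
polynomials `h` of the four blocks. -/
def minOrder {n m r : ℕ} (P : VROP n m r) (fl fu : ℝ) : ℕ :=
  (Finset.univ.sup fun j => ((P.h₁ fl fu j).totalDegree + 1) / 2) ⊔
  (Finset.univ.sup fun j => ((P.h₂ j).totalDegree + 1) / 2) ⊔
  (Finset.univ.sup fun j => ((h₃ n j).totalDegree + 1) / 2) ⊔
  (Finset.univ.sup fun j => ((h₄ n fl fu j).totalDegree + 1) / 2)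

/-- `φ ∈ ℝ[x]` is feasible for the sparse relaxation of order `k`: its degree is at most `2k`, and
`φ(x) - z` is a sum of four terms `σ_{i,0} + ∑_j σ_{i,j} h_{i,j}`, `i = 1, 2, 3, 4`, with sums of
squares multipliers in the variables `{x, y, z}`, `{y}`, `{x}`, `{z}` respectively, in which
`σ_{i,0}` and `σ_{i,j} h_{i,j}` all have degree at most `2k`. -/
def SparseFeasible {n m r : ℕ} (P : VROP n m r) (fl fu : ℝ) (k : ℕ)
    (φ : MvPolynomial (Fin n) ℝ) : Prop :=
  φ.totalDegree ≤ 2 * k ∧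
  ∃ f₁ ∈ truncQuadModule Set.univ (P.h₁ fl fu) (2 * k),
  ∃ f₂ ∈ truncQuadModule (Set.range Var.y) P.h₂ (2 * k),
  ∃ f₃ ∈ truncQuadModule (Set.range Var.x) (h₃ n) (2 * k),
  ∃ f₄ ∈ truncQuadModule {Var.z} (h₄ n fl fu) (2 * k),
    inX φ - X Var.z = f₁ + f₂ + f₃ + f₄

/-- The optimal value of the sparse relaxation of order `k`, an infimum in the extended reals. -/
def sparseValue {n m r : ℕ} (P : VROP n m r) (fl fu : ℝ) (k : ℕ) : EReal :=
  ⨅ (φ : MvPolynomial (Fin n) ℝ) (_ : P.SparseFeasible fl fu k φ),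
    ((∫ x, eval x φ ∂(cubeMeasure n) : ℝ) : EReal)

end VROP

end

/-! Evaluating a feasible identity on `K` makes the right side nonnegative, so every feasible `φ`
dominates `ψ̃` on the cube and the relaxation values are at least `∫ ψ̃`. It remains to find
feasible `φ` with integral close to `∫ ψ̃`.

Analytic half: `K` is compact, so `ψ̃` is the pointwise limit of the continuous functions `psiReg`,
which lie above it. Dominated convergence and Stone–Weierstrass then give a polynomial `φ` with `z <
φ(x)` on `K` and integral as close to `∫ ψ̃` as desired (`exists_mvPolynomial_integral_lt`).

Algebraic half: such a `φ` is feasible for all large orders (`sparseFeasible_of_forall_lt`). A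
constraint `h` can be released by subtracting `l (1 - h/c)^(2k) h`, which preserves positivity on a
compact set. The multiplier is the square of a polynomial in `h`, hence uses only the variables of
`h`, and this is what respects the sparsity. After all four blocks are released, the remainder is
positive on a large box. It then lies in the preordering of the ball polynomial
(`mem_preorderingOf_ball_of_pos_on_box`), whose elements are allowed in block 1, where all variables
occur.

The box statement rests on Bernstein expansion: in high degree all coefficients of a polynomial
positive on the unit box are positive. -/

/-! ### Bernstein expansion on the unit box -/

/-- The coefficients of `t ^ k` in the Bernstein basis of degree `d` approximate the values
`(i / d) ^ k`. -/
lemma abs_choose_div_choose_sub_pow_le {d i : ℕ} (hi : i ≤ d) (k : ℕ) (hk : k ≤ d) :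
    |(i.choose k : ℝ) / d.choose k - ((i : ℝ) / d) ^ k| ≤ (k : ℝ) ^ 2 / d := by
  induction k with
  | zero => simp
  | succ k ih =>
    have ih := ih (by omega)
    have hd : (0 : ℝ) < d := by exact_mod_cast (by omega : 0 < d)
    have hkd : (0 : ℝ) < (d : ℝ) - k := by
      have : ((k + 1 : ℕ) : ℝ) ≤ d := by exact_mod_cast hk
      push_cast at this; linarith
    have hid : (i : ℝ) ≤ d := by exact_mod_cast hi
    have hc : (0 : ℝ) < d.choose k := by exact_mod_cast Nat.choose_pos (by omega)
    -- The ratio is a product of factors `(i - l) / (d - l)`, each within `l / d` of `i / d`.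
    -- Truncated subtraction is harmless: for `i < k` the binomial `i.choose k` already vanishes.
    have e1 : (i.choose (k + 1) : ℝ) / d.choose (k + 1)
        = (i.choose k : ℝ) / d.choose k * (((i - k : ℕ) : ℝ) / (d - k)) := by
      have h1 : (i.choose (k + 1) : ℝ) * (k + 1) = i.choose k * ((i - k : ℕ) : ℝ) := by
        exact_mod_cast Nat.choose_succ_right_eq i k
      have h2 : (d.choose (k + 1) : ℝ) * (k + 1) = d.choose k * ((d : ℝ) - k) := by
        rw [← Nat.cast_sub (by omega : k ≤ d)]
        exact_mod_cast Nat.choose_succ_right_eq d k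
      have hk1 : (0 : ℝ) < (k : ℝ) + 1 := by positivity
      rw [div_mul_div_comm, ← h1, ← h2, mul_div_mul_right _ _ hk1.ne']
    have e2 : |((i - k : ℕ) : ℝ) / (d - k) - (i : ℝ) / d| ≤ k / d := by
      rcases le_total i k with h | h
      · rw [Nat.sub_eq_zero_of_le h]
        simp only [Nat.cast_zero, zero_div, zero_sub, abs_neg]
        rw [abs_of_nonneg (by positivity)]
        gcongr
      · rw [Nat.cast_sub h]
        have h' : (k : ℝ) ≤ i := by exact_mod_cast h
        have : ((i : ℝ) - k) / (d - k) - (i : ℝ) / d = - (k / d * ((d - i) / (d - k))) := by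
          field_simp
          ring
        rw [this, abs_neg, abs_of_nonneg (mul_nonneg (by positivity)
          (div_nonneg (by linarith) hkd.le))]
        refine mul_le_of_le_one_right (by positivity) ?_
        rw [div_le_one hkd]; linarith
    have r0 : 0 ≤ (i.choose k : ℝ) / d.choose k := by positivity
    have r1 : (i.choose k : ℝ) / d.choose k ≤ 1 := by
      rw [div_le_one hc]; exact_mod_cast Nat.choose_le_choose k hi
    have t0 : 0 ≤ (i : ℝ) / d := by positivity
    have t1 : (i : ℝ) / d ≤ 1 := by rw [div_le_one hd]; exact hid
    rw [e1, pow_succ]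
    set r := (i.choose k : ℝ) / d.choose k
    set u := ((i - k : ℕ) : ℝ) / (d - k)
    set t := (i : ℝ) / d
    have : r * u - t ^ k * t = r * (u - t) + (r - t ^ k) * t := by ring
    rw [this]
    calc |r * (u - t) + (r - t ^ k) * t| ≤ |r * (u - t)| + |(r - t ^ k) * t| := abs_add_le _ _
      _ ≤ k / d + k ^ 2 / d := by
        rw [abs_mul, abs_mul, abs_of_nonneg r0, abs_of_nonneg t0]
        exact add_le_add ((mul_le_of_le_one_left (abs_nonneg _) r1).trans e2)
          ((mul_le_of_le_one_right (abs_nonneg _) t1).trans ih)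
      _ ≤ ((k + 1 : ℕ) : ℝ) ^ 2 / d := by
        rw [← add_div]; push_cast
        gcongr
        nlinarith [Nat.cast_nonneg (α := ℝ) k]

lemma abs_prod_sub_prod_le_sum {ι : Type*} (s : Finset ι) (f g : ι → ℝ)
    (hf : ∀ i ∈ s, 0 ≤ f i ∧ f i ≤ 1) (hg : ∀ i ∈ s, 0 ≤ g i ∧ g i ≤ 1) :
    |∏ i ∈ s, f i - ∏ i ∈ s, g i| ≤ ∑ i ∈ s, |f i - g i| := by
  classical
  induction s using Finset.induction_on with
  | empty => simp
  | insert a s ha ih =>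
    rw [Finset.prod_insert ha, Finset.prod_insert ha, Finset.sum_insert ha]
    have ih := ih (fun i hi => hf i (Finset.mem_insert_of_mem hi))
      (fun i hi => hg i (Finset.mem_insert_of_mem hi))
    have hga := hg a (Finset.mem_insert_self _ _)
    have p0 : 0 ≤ ∏ i ∈ s, f i :=
      Finset.prod_nonneg fun i hi => (hf i (Finset.mem_insert_of_mem hi)).1
    have p1 : ∏ i ∈ s, f i ≤ 1 :=
      Finset.prod_le_one (fun i hi => (hf i (Finset.mem_insert_of_mem hi)).1)
        fun i hi => (hf i (Finset.mem_insert_of_mem hi)).2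
    have : f a * ∏ i ∈ s, f i - g a * ∏ i ∈ s, g i
        = (f a - g a) * ∏ i ∈ s, f i + g a * (∏ i ∈ s, f i - ∏ i ∈ s, g i) := by ring
    rw [this]
    refine (abs_add_le _ _).trans ?_
    rw [abs_mul, abs_mul, abs_of_nonneg p0, abs_of_nonneg hga.1]
    exact add_le_add (mul_le_of_le_one_right (abs_nonneg _) p1)
      ((mul_le_of_le_one_left (abs_nonneg _) hga.2).trans ih)

/-- Since `C(d,i) C(i,k) = C(d,k) C(d-k,i-k)`, the terms with `i ≥ k` form the binomial expansion of
`(a + (1 - a)) ^ (d - k)`. -/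
lemma sum_choose_mul_choose_mul_pow {A : Type*} [CommRing A] (a : A) {d k : ℕ} (hk : k ≤ d) :
    ∑ i ∈ Finset.range (d + 1), ((d.choose i * i.choose k : ℕ) : A) * (a ^ i * (1 - a) ^ (d - i))
      = (d.choose k : A) * a ^ k := by
  obtain ⟨e, rfl⟩ := Nat.exists_eq_add_of_le hk
  rw [add_assoc, Finset.sum_range_add, Finset.sum_eq_zero, zero_add]
  · have : ((k + e).choose k : A) * a ^ k = (k + e).choose k * a ^ k * (a + (1 - a)) ^ e := by
      simp
    rw [this, add_pow, Finset.mul_sum]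
    refine Finset.sum_congr rfl fun l hl => ?_
    rw [Nat.choose_mul (Nat.le_add_right k l), Nat.add_sub_cancel_left, Nat.add_sub_cancel_left,
      Nat.add_sub_add_left]
    push_cast
    ring
  · intro i hi
    rw [Nat.choose_eq_zero_of_lt (Finset.mem_range.1 hi)]
    simp

/-- Expansion of a power in the Bernstein basis. -/
lemma pow_eq_sum_bernstein {A : Type*} [CommRing A] [Algebra ℝ A] (a : A) {d k : ℕ}
    (hk : k ≤ d) :
    a ^ k = ∑ i ∈ Finset.range (d + 1), algebraMap ℝ A ((i.choose k : ℝ) / d.choose k) *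
      ((d.choose i : A) * (a ^ i * (1 - a) ^ (d - i))) := by
  have hc : (d.choose k : ℝ) ≠ 0 := by exact_mod_cast (Nat.choose_pos hk).ne'
  have := congrArg (fun u => algebraMap ℝ A ((d.choose k : ℝ)⁻¹) * u)
    (sum_choose_mul_choose_mul_pow a hk)
  simp only [← map_natCast (algebraMap ℝ A) (d.choose k), ← mul_assoc, ← map_mul,
    inv_mul_cancel₀ hc, map_one, one_mul, Finset.mul_sum] at this
  rw [← this]
  refine Finset.sum_congr rfl fun i _ => ?_
  rw [div_eq_mul_inv, map_mul, map_natCast]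
  push_cast
  ring

/-- A polynomial which is positive on the unit box, evaluated at elements `a j` of an algebra, lies
in every subsemiring that contains the nonnegative scalars, the `a j` and the `1 - a j`. -/
theorem aeval_mem_of_pos_on_unitBox {A τ : Type*} [CommRing A] [Algebra ℝ A] [Fintype τ]
    (T : Subsemiring A) (hT : ∀ c : ℝ, 0 ≤ c → algebraMap ℝ A c ∈ T) (a : τ → A)
    (ha : ∀ j, a j ∈ T) (ha' : ∀ j, 1 - a j ∈ T) (F : MvPolynomial τ ℝ)
    (hF : ∀ t : τ → ℝ, (∀ j, 0 ≤ t j ∧ t j ≤ 1) → 0 < eval t F) : aeval a F ∈ T := by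
  classical
  have hcpt : IsCompact (Set.Icc (0 : τ → ℝ) 1) := isCompact_Icc
  obtain ⟨t₀, ht₀, hmin⟩ := hcpt.exists_isMinOn ⟨0, by simp⟩
    ((MvPolynomial.continuous_eval F).continuousOn)
  have hm : 0 < eval t₀ F := hF t₀ fun j => ⟨ht₀.1 j, ht₀.2 j⟩
  set μ := eval t₀ F
  -- The Bernstein coefficient at the multi-index `i` differs from the value of `F` at `i / d` by at
  -- most `c / d`. Taking `d > c / μ` makes every coefficient positive; `d` must also dominate all
  -- exponents of `F`.
  set c : ℝ := ∑ s ∈ F.support, |coeff s F| * ∑ j, (s j : ℝ) ^ 2 with hcdef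
  obtain ⟨N, hN⟩ := exists_nat_gt (c / μ)
  set d : ℕ := max (N + 1) F.totalDegree with hd
  have hd0 : (0 : ℝ) < d := by
    have : 0 < d := lt_of_lt_of_le (Nat.succ_pos N) (le_max_left _ _)
    exact_mod_cast this
  have hdc : c / d < μ := by
    rw [div_lt_iff₀ hd0]
    rw [div_lt_iff₀ hm] at hN
    have : (N : ℝ) ≤ d := by exact_mod_cast (Nat.le_succ N).trans (le_max_left _ _)
    nlinarith
  have hsd : ∀ s ∈ F.support, ∀ j, s j ≤ d := fun s hs j =>
    ((Finsupp.le_degree j s).trans (le_totalDegree hs)).trans (le_max_right _ _)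
  set b : ℕ → A → A := fun i x => (d.choose i : A) * (x ^ i * (1 - x) ^ (d - i)) with hb
  set r : ℕ → ℕ → ℝ := fun i k => (i.choose k : ℝ) / d.choose k with hr
  have key : aeval a F = ∑ i ∈ Fintype.piFinset (fun _ : τ => Finset.range (d + 1)),
      algebraMap ℝ A (∑ s ∈ F.support, coeff s F * ∏ j, r (i j) (s j)) * ∏ j, b (i j) (a j) := by
    rw [aeval_def, eval₂_eq']
    simp_rw [map_sum, Finset.sum_mul]
    rw [Finset.sum_comm]
    refine Finset.sum_congr rfl fun s hs => ?_
    have : ∏ j, a j ^ s j = ∏ j, ∑ i ∈ Finset.range (d + 1), algebraMap ℝ A (r i (s j)) *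
        b i (a j) := Finset.prod_congr rfl fun j _ => pow_eq_sum_bernstein (a j) (hsd s hs j)
    rw [this, Finset.prod_univ_sum, Finset.mul_sum]
    refine Finset.sum_congr rfl fun i _ => ?_
    rw [Finset.prod_mul_distrib, map_mul, map_prod, mul_assoc]
  rw [key]
  refine T.sum_mem fun i hi => T.mul_mem (hT _ ?_) (T.prod_mem fun j _ => ?_)
  · rw [Fintype.mem_piFinset] at hi
    have hid : ∀ j, i j ≤ d := fun j => Nat.lt_succ_iff.1 (Finset.mem_range.1 (hi j))
    set t : τ → ℝ := fun j => (i j : ℝ) / d with ht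
    have ht0 : ∀ j, 0 ≤ t j ∧ t j ≤ 1 := fun j =>
      ⟨by positivity, by rw [ht, div_le_one hd0]; exact_mod_cast hid j⟩
    have hge : μ ≤ eval t F := hmin ⟨fun j => (ht0 j).1, fun j => (ht0 j).2⟩
    have hdiff : |∑ s ∈ F.support, coeff s F * ∏ j, r (i j) (s j) - eval t F| ≤ c / d := by
      rw [eval_eq', ← Finset.sum_sub_distrib, hcdef, Finset.sum_div]
      refine (Finset.abs_sum_le_sum_abs _ _).trans (Finset.sum_le_sum fun s hs => ?_)
      rw [← mul_sub, abs_mul, mul_div_assoc]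
      refine mul_le_mul_of_nonneg_left ?_ (abs_nonneg _)
      refine (abs_prod_sub_prod_le_sum _ _ _ (fun j _ => ⟨by positivity, ?_⟩)
        (fun j _ => ⟨pow_nonneg (ht0 j).1 _, pow_le_one₀ (ht0 j).1 (ht0 j).2⟩)).trans ?_
      · have : (0 : ℝ) < d.choose (s j) := by exact_mod_cast Nat.choose_pos (hsd s hs j)
        rw [hr, div_le_one this]
        exact_mod_cast Nat.choose_le_choose _ (hid j)
      · rw [Finset.sum_div]
        exact Finset.sum_le_sum fun j _ =>
          abs_choose_div_choose_sub_pow_le (hid j) _ (hsd s hs j)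
    have := (abs_le.1 hdiff).1
    linarith
  · exact T.mul_mem (natCast_mem T _) (T.mul_mem (T.pow_mem (ha j) _) (T.pow_mem (ha' j) _))

/-! ### Releasing constraints with square multipliers -/

/-- Bernoulli gives `n t ≤ (1 + t) ^ n`, and `(1 + t) (1 - t) ≤ 1`. This makes the correction term
small where the constraint holds. -/
lemma natCast_mul_mul_one_sub_pow_le_one {t : ℝ} (h0 : 0 ≤ t) (h1 : t ≤ 1) (n : ℕ) :
    n * (t * (1 - t) ^ n) ≤ 1 := by
  have hb : 1 + n * t ≤ (1 + t) ^ n := one_add_mul_le_pow (by linarith) n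
  have hp : 0 ≤ (1 - t) ^ n := pow_nonneg (by linarith) n
  calc n * (t * (1 - t) ^ n) = n * t * (1 - t) ^ n := by ring
    _ ≤ (1 + t) ^ n * (1 - t) ^ n := mul_le_mul_of_nonneg_right (by linarith) hp
    _ = (1 - t ^ 2) ^ n := by rw [← mul_pow]; ring
    _ ≤ 1 := pow_le_one₀ (by nlinarith) (by nlinarith)

/-- A constraint `0 ≤ h` can be removed by subtracting `l (1 - h / c) ^ (2 k) h`. -/
lemma exists_pos_sub_mul_pow_mul {X : Type*} [TopologicalSpace X] {B : Set X} (hB : IsCompact B)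
    {f h : X → ℝ} (hf : Continuous f) (hh : Continuous h) {c : ℝ} (hc : 0 < c)
    (hbd : ∀ x ∈ B, h x ≤ c) (hpos : ∀ x ∈ B, 0 ≤ h x → 0 < f x) :
    ∃ l : ℝ, 0 ≤ l ∧ ∃ k : ℕ, ∀ x ∈ B, 0 < f x - l * (1 - h x / c) ^ (2 * k) * h x := by
  -- Where `f ≤ 0` the constraint is violated, so `f / h` is continuous on a compact set and any `l`
  -- above its supremum works.
  obtain ⟨l, hl0, hl⟩ : ∃ l : ℝ, 0 ≤ l ∧ ∀ x ∈ B, f x ≤ 0 → 0 < f x - l * h x := by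
    have hS : IsCompact (B ∩ {x | f x ≤ 0}) := hB.inter_right (isClosed_le hf continuous_const)
    have hneg : ∀ x ∈ B ∩ {x | f x ≤ 0}, h x < 0 := fun x hx =>
      not_le.1 fun h' => absurd (hpos x hx.1 h') (not_lt.2 hx.2)
    obtain ⟨b, hb⟩ := hS.exists_bound_of_continuousOn
      (f := fun x => f x / h x) (hf.continuousOn.div hh.continuousOn fun x hx => (hneg x hx).ne)
    refine ⟨|b| + 1, by positivity, fun x hxB hx => ?_⟩
    have h1 := hneg x ⟨hxB, hx⟩
    have h2 : f x / h x < |b| + 1 := by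
      have := (le_abs_self _).trans ((hb x ⟨hxB, hx⟩).trans (le_abs_self b))
      linarith
    rw [div_lt_iff_of_neg h1] at h2
    linarith
  obtain ⟨μ, hμ0, hμ⟩ := (hB.inter_right (isClosed_le continuous_const hh)).exists_forall_le'
    (f := f) (a := 0) hf.continuousOn fun x hx => hpos x hx.1 hx.2
  -- Where `h < 0` the power is at least 1 and only increases the gain `-l h`. Where `h ≥ 0` the
  -- correction is of size at most `l c / k`, below the minimum `μ` of `f`.
  obtain ⟨k, hk⟩ := exists_nat_gt (l * c / μ)
  have hk0 : (0 : ℝ) < k := lt_of_le_of_lt (by positivity) hk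
  refine ⟨l, hl0, k, fun x hx => ?_⟩
  rcases lt_or_ge (h x) 0 with hneg | hnn
  · have hP : 1 ≤ (1 - h x / c) ^ (2 * k) :=
      one_le_pow₀ (by linarith [div_neg_of_neg_of_pos hneg hc])
    have h3 : l * h x ≥ l * (1 - h x / c) ^ (2 * k) * h x := by
      have : l * 1 ≤ l * (1 - h x / c) ^ (2 * k) := mul_le_mul_of_nonneg_left hP hl0
      nlinarith
    rcases le_or_gt (f x) 0 with h' | h'
    · linarith [hl x hx h']
    · nlinarith
  · have ht0 : 0 ≤ h x / c := by positivity
    have ht1 : h x / c ≤ 1 := by rw [div_le_one hc]; exact hbd x hx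
    have hq := natCast_mul_mul_one_sub_pow_le_one ht0 ht1 (2 * k)
    have hμx := hμ x ⟨hx, hnn⟩
    have e : l * (1 - h x / c) ^ (2 * k) * h x
        = l * c * (h x / c * (1 - h x / c) ^ (2 * k)) := by field_simp
    rw [e]
    set v := h x / c * (1 - h x / c) ^ (2 * k)
    have hv : 0 ≤ v := mul_nonneg ht0 (pow_nonneg (by linarith) _)
    have hkv : k * v ≤ 1 := by push_cast at hq; nlinarith
    rw [div_lt_iff₀ hμ0] at hk
    have h4 : l * c * v ≤ k * μ * v := mul_le_mul_of_nonneg_right hk.le hv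
    rcases hv.eq_or_lt with hv0 | hv0
    · rw [← hv0]; linarith
    · have : l * c * v < k * μ * v := mul_lt_mul_of_pos_right hk hv0
      nlinarith

section SumsOfSquares

variable {τ ι : Type*} {I : Set τ}

lemma IsSOSIn.mul_self {p : MvPolynomial τ ℝ} (hp : p ∈ supported ℝ I) : IsSOSIn I (p * p) := by
  lift p to supported ℝ I using hp
  refine ⟨p * p, ?_, ?_⟩
  · exact IsSumSq.mul_self p
  · rw [MulMemClass.coe_mul]

lemma IsSOSIn.zero : IsSOSIn I (0 : MvPolynomial τ ℝ) := ⟨0, IsSumSq.zero, by rw [ZeroMemClass.coe_zero]⟩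

lemma IsSOSIn.add {f g : MvPolynomial τ ℝ} (hf : IsSOSIn I f) (hg : IsSOSIn I g) :
    IsSOSIn I (f + g) := by
  obtain ⟨s, hs, rfl⟩ := hf
  obtain ⟨t, ht, rfl⟩ := hg
  exact ⟨s + t, hs.add ht, by rw [AddMemClass.coe_add]⟩

lemma IsSumSq.isSOSIn_univ {f : MvPolynomial τ ℝ} (hf : IsSumSq f) : IsSOSIn Set.univ f := by
  induction hf using IsSumSq.rec' with
  | zero => exact IsSOSIn.zero
  | sq_add hx hs ih =>
    obtain ⟨a, rfl⟩ := hx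
    exact (IsSOSIn.mul_self (by rw [supported_univ]; trivial)).add ih

lemma IsSOSIn.eval_nonneg {f : MvPolynomial τ ℝ} (hf : IsSOSIn I f) (x : τ → ℝ) :
    0 ≤ eval x f := by
  obtain ⟨s, hs, rfl⟩ := hf
  induction hs using IsSumSq.rec' with
  | zero => simp
  | sq_add hx hs ih =>
    obtain ⟨a, rfl⟩ := hx
    simpa using add_nonneg (mul_self_nonneg (eval x (a : MvPolynomial τ ℝ))) ih

variable [Fintype ι] {h : ι → MvPolynomial τ ℝ}

lemma truncQuadModule_mono {d e : ℕ} (hde : d ≤ e) :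
    truncQuadModule I h d ⊆ truncQuadModule I h e := by
  rintro f ⟨σ₀, σ, h0, h1, h2, h3, rfl⟩
  exact ⟨σ₀, σ, h0, h1, h2.trans hde, fun j => (h3 j).trans hde, rfl⟩

lemma zero_mem_truncQuadModule (d : ℕ) : 0 ∈ truncQuadModule I h d :=
  ⟨0, 0, IsSOSIn.zero, fun _ => IsSOSIn.zero, by simp, by simp, by simp⟩

lemma add_mem_truncQuadModule {f g : MvPolynomial τ ℝ} {d : ℕ} (hf : f ∈ truncQuadModule I h d)
    (hg : g ∈ truncQuadModule I h d) : f + g ∈ truncQuadModule I h d := by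
  obtain ⟨σ₀, σ, h0, h1, h2, h3, rfl⟩ := hf
  obtain ⟨τ₀, τ, k0, k1, k2, k3, rfl⟩ := hg
  refine ⟨σ₀ + τ₀, σ + τ, h0.add k0, fun j => (h1 j).add (k1 j),
    (totalDegree_add _ _).trans (max_le h2 k2), fun j => ?_, ?_⟩
  · rw [Pi.add_apply, add_mul]
    exact (totalDegree_add _ _).trans (max_le (h3 j) (k3 j))
  · simp only [Pi.add_apply, add_mul, Finset.sum_add_distrib]
    ring

lemma sos_add_mul_mem_truncQuadModule {σ₀ σ : MvPolynomial τ ℝ} (h0 : IsSOSIn I σ₀)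
    (hσ : IsSOSIn I σ) (j : ι) : ∃ d, σ₀ + σ * h j ∈ truncQuadModule I h d := by
  classical
  refine ⟨max σ₀.totalDegree (σ * h j).totalDegree, σ₀, Pi.single j σ, h0, fun i => ?_,
    le_max_left _ _, fun i => ?_, ?_⟩
  · by_cases hij : i = j
    · subst hij; simpa using hσ
    · simpa [hij] using IsSOSIn.zero
  · by_cases hij : i = j
    · subst hij; simp
    · simp [hij]
  · rw [Finset.sum_eq_single j (by intro i _ hij; simp [hij]) (by simp)]
    simp

lemma eval_nonneg_of_mem_truncQuadModule {f : MvPolynomial τ ℝ} {d : ℕ}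
    (hf : f ∈ truncQuadModule I h d) {x : τ → ℝ} (hx : ∀ j, 0 ≤ eval x (h j)) :
    0 ≤ eval x f := by
  obtain ⟨σ₀, σ, h0, h1, -, -, rfl⟩ := hf
  rw [map_add, map_sum]
  refine add_nonneg (h0.eval_nonneg x) (Finset.sum_nonneg fun j _ => ?_)
  rw [map_mul]
  exact mul_nonneg ((h1 j).eval_nonneg x) (hx j)

/-- A polynomial that is positive where the constraints `0 ≤ h j` hold becomes positive on the whole
compact set after subtracting an element of the quadratic module of the `h j`. -/
theorem exists_mem_truncQuadModule_pos_sub (hI : ∀ j, h j ∈ supported ℝ I) {B : Set (τ → ℝ)}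
    (hB : IsCompact B) (f : MvPolynomial τ ℝ)
    (hf : ∀ x ∈ B, (∀ j, 0 ≤ eval x (h j)) → 0 < eval x f) :
    ∃ d, ∃ u ∈ truncQuadModule I h d, ∀ x ∈ B, 0 < eval x (f - u) := by
  classical
  suffices H : ∀ (s : Finset ι) (f : MvPolynomial τ ℝ),
      (∀ x ∈ B, (∀ j ∈ s, 0 ≤ eval x (h j)) → 0 < eval x f) →
      ∃ d, ∃ u ∈ truncQuadModule I h d, ∀ x ∈ B, 0 < eval x (f - u) from
    H Finset.univ f fun x hx hj => hf x hx fun j => hj j (Finset.mem_univ j)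
  intro s
  induction s using Finset.induction_on with
  | empty =>
    intro f hf
    exact ⟨0, 0, zero_mem_truncQuadModule 0, fun x hx => by simpa using hf x hx (by simp)⟩
  | insert a s has ih =>
    intro f hf
    -- Constraint `a` is released on the part of `B` where those in `s` hold; the corrected
    -- polynomial is positive there, as the induction hypothesis requires.
    have hcl : IsClosed {x : τ → ℝ | ∀ j ∈ s, 0 ≤ eval x (h j)} := by
      simp only [Set.ofPred_forall]
      exact isClosed_biInter fun j _ => isClosed_le continuous_const (continuous_eval _)
    have hB' := hB.inter_right hcl
    obtain ⟨b, hb⟩ := hB'.exists_bound_of_continuousOn (f := fun x => eval x (h a))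
      (continuous_eval _).continuousOn
    obtain ⟨l, hl0, k, hlk⟩ := exists_pos_sub_mul_pow_mul hB' (continuous_eval f)
      (continuous_eval (h a)) (c := |b| + 1) (by positivity)
      (fun x hx => by
        have := (le_abs_self _).trans ((hb x hx).trans (le_abs_self b))
        linarith)
      (fun x hx h0 => hf x hx.1 fun j hj => by
        rcases Finset.mem_insert.1 hj with rfl | hj
        · exact h0
        · exact hx.2 j hj)
    -- A square root of the multiplier `l (1 - h a / c) ^ (2 k)`; as a polynomial in `h a` it stays
    -- in `ℝ[I]`.
    set p : MvPolynomial τ ℝ := C (Real.sqrt l) * (1 - C (|b| + 1)⁻¹ * h a) ^ k with hp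
    have hpI : p ∈ supported ℝ I :=
      mul_mem (Subalgebra.algebraMap_mem _ _) (pow_mem (sub_mem (one_mem _)
        (mul_mem (Subalgebra.algebraMap_mem _ _) (hI a))) _)
    have hpe : ∀ x, eval x (p * p * h a)
        = l * (1 - eval x (h a) / (|b| + 1)) ^ (2 * k) * eval x (h a) := by
      intro x
      simp only [hp, map_mul, map_pow, map_sub, map_one, eval_C]
      rw [div_eq_inv_mul, two_mul, pow_add]
      nth_rewrite 3 [← Real.mul_self_sqrt hl0]
      ring
    obtain ⟨d₁, u₁, hu₁, hpos⟩ := ih (f - p * p * h a) fun x hx hj => by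
      rw [map_sub, hpe]
      exact hlk x ⟨hx, hj⟩
    obtain ⟨d₂, hu₂⟩ := sos_add_mul_mem_truncQuadModule (h := h) IsSOSIn.zero
      (IsSOSIn.mul_self hpI) a
    rw [zero_add] at hu₂
    refine ⟨max d₁ d₂, p * p * h a + u₁, add_mem_truncQuadModule
      (truncQuadModule_mono (le_max_right _ _) hu₂)
      (truncQuadModule_mono (le_max_left _ _) hu₁), fun x hx => ?_⟩
    rw [← sub_sub]
    exact hpos x hx

end SumsOfSquares

/-! ### Positivity on a box and the preordering of a ball -/

/-- The preordering generated by a single element `G`. -/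
def preorderingOf {A : Type*} [CommRing A] (G : A) : Subsemiring A where
  carrier := {f | ∃ s₀ s₁ : A, IsSumSq s₀ ∧ IsSumSq s₁ ∧ f = s₀ + s₁ * G}
  zero_mem' := ⟨0, 0, IsSumSq.zero, IsSumSq.zero, by simp⟩
  one_mem' := ⟨1, 0, IsSumSq.one, IsSumSq.zero, by simp⟩
  add_mem' := by
    rintro _ _ ⟨s₀, s₁, h0, h1, rfl⟩ ⟨t₀, t₁, k0, k1, rfl⟩
    exact ⟨s₀ + t₀, s₁ + t₁, h0.add k0, h1.add k1, by ring⟩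
  mul_mem' := by
    rintro _ _ ⟨s₀, s₁, h0, h1, rfl⟩ ⟨t₀, t₁, k0, k1, rfl⟩
    -- The product of the two `G` terms carries the square `G * G`, so for a single generator the
    -- quadratic module is closed under multiplication.
    exact ⟨s₀ * t₀ + s₁ * t₁ * (G * G), s₀ * t₁ + s₁ * t₀,
      (h0.mul k0).add ((h1.mul k1).mul (IsSumSq.mul_self G)), (h0.mul k1).add (h1.mul k0),
      by ring⟩

lemma mem_preorderingOf {A : Type*} [CommRing A] {G f : A} :
    f ∈ preorderingOf G ↔ ∃ s₀ s₁ : A, IsSumSq s₀ ∧ IsSumSq s₁ ∧ f = s₀ + s₁ * G := Iff.rfl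

lemma IsSumSq.mem_preorderingOf {A : Type*} [CommRing A] {G f : A} (hf : IsSumSq f) :
    f ∈ preorderingOf G := ⟨f, 0, hf, IsSumSq.zero, by simp⟩

lemma MvPolynomial.isSumSq_C {τ : Type*} {c : ℝ} (hc : 0 ≤ c) :
    IsSumSq (C c : MvPolynomial τ ℝ) := by
  rw [← Real.mul_self_sqrt hc, C_mul]
  exact IsSumSq.mul_self _

/-- A polynomial that is positive on a box containing the ball `∑ x_i² ≤ ρ` belongs
to the preordering generated by `ρ - ∑ x_i²`. -/
theorem mem_preorderingOf_ball_of_pos_on_box {τ : Type*} [Fintype τ] {ρ R : ℝ} (hR : 0 < R)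
    (hρ : ρ ≤ R ^ 2) (f : MvPolynomial τ ℝ)
    (hf : ∀ x : τ → ℝ, (∀ j, -R ≤ x j ∧ x j ≤ R) → 0 < eval x f) :
    f ∈ preorderingOf (C ρ - ∑ j, X j ^ 2 : MvPolynomial τ ℝ) := by
  classical
  set G : MvPolynomial τ ℝ := C ρ - ∑ j, X j ^ 2 with hG
  have hsq : ∀ j, C (R ^ 2) - X j ^ 2 ∈ preorderingOf G := by
    intro j
    have : C (R ^ 2) - X j ^ 2 = (C (R ^ 2 - ρ) + ∑ i ∈ Finset.univ.erase j, X i ^ 2) + 1 * G := by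
      rw [hG, ← Finset.add_sum_erase _ _ (Finset.mem_univ j), C_sub]
      ring
    exact ⟨_, 1, (isSumSq_C (by linarith)).add (IsSumSq.sum_sq _ _), IsSumSq.one, this⟩
  -- From `2R (R + p) = (R + p)² + (R² - p²)`. The cases `p = X j` and `p = -X j` give the rescaled
  -- coordinate `a j` and `1 - a j`.
  have hlin : ∀ (j : τ) (p : MvPolynomial τ ℝ), p ^ 2 = X j ^ 2 →
      C (2 * R)⁻¹ * (C R + p) ∈ preorderingOf G := by
    intro j p hp
    have hC : (C (2 * R)⁻¹ : MvPolynomial τ ℝ) * (2 * C R) = 1 := by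
      rw [← map_ofNat (C : ℝ →+* MvPolynomial τ ℝ) 2, ← C_mul, ← C_mul,
        inv_mul_cancel₀ (by positivity), C_1]
    have : C (2 * R)⁻¹ * (C R + p)
        = C (2 * R)⁻¹ * (C (2 * R)⁻¹ * ((C R + p) * (C R + p) + (C (R ^ 2) - X j ^ 2))) := by
      rw [← hp, C_pow]
      linear_combination -(C (2 * R)⁻¹ * (C R + p)) * hC
    rw [this]
    have hc := (isSumSq_C (τ := τ) (c := (2 * R)⁻¹) (by positivity)).mem_preorderingOf (G := G)
    exact mul_mem hc (mul_mem hc (add_mem (IsSumSq.mul_self _).mem_preorderingOf (hsq j)))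
  have hCC : (C (2 * R) : MvPolynomial τ ℝ) * C (2 * R)⁻¹ = 1 := by
    rw [← C_mul, mul_inv_cancel₀ (by positivity), C_1]
  have hcomp : (aeval (fun j => C (2 * R)⁻¹ * (C R + X j) : τ → MvPolynomial τ ℝ)).comp
      (aeval (fun j => C (2 * R) * X j - C R : τ → MvPolynomial τ ℝ)) = AlgHom.id ℝ _ := by
    refine MvPolynomial.algHom_ext fun j => ?_
    simp only [AlgHom.comp_apply, aeval_X, map_sub, map_mul, algHom_C, algebraMap_eq,
      AlgHom.id_apply]
    rw [C_mul] at hCC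
    linear_combination (C R + X j) * hCC
  have hFf := DFunLike.congr_fun hcomp f
  rw [AlgHom.comp_apply, AlgHom.id_apply] at hFf
  rw [← hFf]
  refine aeval_mem_of_pos_on_unitBox _ (fun c hc => (isSumSq_C hc).mem_preorderingOf) _
    (fun j => hlin j _ rfl) (fun j => ?_) _ fun t ht => ?_
  · have : (1 : MvPolynomial τ ℝ) - C (2 * R)⁻¹ * (C R + X j) = C (2 * R)⁻¹ * (C R + -X j) := by
      have : (C (2 * R) : MvPolynomial τ ℝ) = 2 * C R := by rw [C_mul, map_ofNat]
      rw [this] at hCC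
      linear_combination -hCC
    rw [this]
    exact hlin j _ (by ring)
  · have hev : (aeval t).comp (aeval (fun j => C (2 * R) * X j - C R : τ → MvPolynomial τ ℝ))
        = aeval (fun j => 2 * R * t j - R) := by
      refine MvPolynomial.algHom_ext fun j => ?_
      simp
    have := DFunLike.congr_fun hev f
    simp only [AlgHom.comp_apply, aeval_eq_eval] at this
    rw [this]
    exact hf _ fun j => ⟨by nlinarith [(ht j).1], by nlinarith [(ht j).2]⟩

/-! ### The four blocks and the sparse certificate -/

/-- The point `(x, y, z)`. -/
def Var.point {n : ℕ} (x y : Fin n → ℝ) (z : ℝ) : Var n → ℝ :=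
  Sum.elim x (Sum.elim y fun _ => z)

lemma Var.eq_point {n : ℕ} (w : Var n → ℝ) :
    w = Var.point (fun j => w (Var.x j)) (fun j => w (Var.y j)) (w Var.z) := by
  funext v
  rcases v with j | j | _ <;> rfl

lemma Var.eval_inX {n : ℕ} (x y : Fin n → ℝ) (z : ℝ) (f : MvPolynomial (Fin n) ℝ) :
    eval (Var.point x y z) (inX f) = eval x f := by
  rw [inX, eval_rename]; rfl

lemma Var.eval_inY {n : ℕ} (x y : Fin n → ℝ) (z : ℝ) (f : MvPolynomial (Fin n) ℝ) :
    eval (Var.point x y z) (inY f) = eval y f := by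
  rw [inY, eval_rename]; rfl

lemma mem_cube_iff_one_sub_sq {n : ℕ} {x : Fin n → ℝ} : x ∈ cube n ↔ ∀ j, 0 ≤ 1 - x j ^ 2 := by
  have : ∀ j, 0 ≤ 1 - x j ^ 2 ↔ -1 ≤ x j ∧ x j ≤ 1 := fun j => by
    rw [sub_nonneg, sq_le_one_iff_abs_le_one, abs_le]
  simp only [this, cube, Set.mem_Icc, Pi.le_def, forall_and]

namespace VROP

variable {n m r : ℕ} (P : VROP n m r) {fl fu : ℝ}

lemma eval_h₁_inl (x y : Fin n → ℝ) (z : ℝ) (i : Fin m) :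
    eval (Var.point x y z) (P.h₁ fl fu (Sum.inl i)) =
      eval x (P.p i) * eval y (P.q i) - eval y (P.p i) * eval x (P.q i)
        - z * eval x (P.q i) * eval y (P.q i) := by
  simp only [h₁, Sum.elim_inl, map_sub, map_mul, Var.eval_inX, Var.eval_inY, eval_X]
  rfl

/-- Grouping the ball polynomial into the box polynomials shows that it is nonnegative on `K`. -/
lemma eval_h₁_inr (x y : Fin n → ℝ) (z : ℝ) :
    eval (Var.point x y z) (P.h₁ fl fu (Sum.inr ())) =
      ∑ j, ((1 - x j ^ 2) + (1 - y j ^ 2)) + ((fu - fl) ^ 2 - z ^ 2) := by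
  have : eval (Var.point x y z) (P.h₁ fl fu (Sum.inr ())) =
      2 * n + (fu - fl) ^ 2 - ∑ j, (x j ^ 2 + y j ^ 2) - z ^ 2 := by
    simp only [h₁, Sum.elim_inr, map_sub, map_pow, map_sum, map_add, eval_C, eval_X]
    rfl
  rw [this]
  simp only [Finset.sum_add_distrib, Finset.sum_sub_distrib, Finset.sum_const, Finset.card_univ,
    Fintype.card_fin, nsmul_eq_mul]
  ring

lemma eval_h₂_inl (x y : Fin n → ℝ) (z : ℝ) (j : Fin r) :
    eval (Var.point x y z) (P.h₂ (Sum.inl j)) = eval y (P.g j) := by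
  simp only [h₂, Sum.elim_inl, Var.eval_inY]

lemma eval_h₂_inr (x y : Fin n → ℝ) (z : ℝ) (j : Fin n) :
    eval (Var.point x y z) (P.h₂ (Sum.inr j)) = 1 - y j ^ 2 := by
  simp only [h₂, Sum.elim_inr, map_sub, map_one, map_pow, eval_X]
  rfl

lemma eval_h₃ (x y : Fin n → ℝ) (z : ℝ) (j : Fin n) :
    eval (Var.point x y z) (h₃ n j) = 1 - x j ^ 2 := by
  simp only [h₃, map_sub, map_one, map_pow, eval_X]
  rfl

lemma eval_h₄ (x y : Fin n → ℝ) (z : ℝ) (j : Unit) :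
    eval (Var.point x y z) (h₄ n fl fu j) = (fu - fl) ^ 2 - z ^ 2 := by
  simp only [h₄, map_sub, map_pow, eval_C, eval_X]
  rfl

lemma h₁_mem_supported (j : Fin m ⊕ Unit) :
    P.h₁ fl fu j ∈ supported ℝ (Set.univ : Set (Var n)) := by
  rw [supported_univ]
  exact Algebra.mem_top

lemma one_sub_X_sq_mem_supported {τ : Type*} {I : Set τ} {v : τ} (hv : v ∈ I) :
    (1 - X v ^ 2 : MvPolynomial τ ℝ) ∈ supported ℝ I :=
  sub_mem (one_mem _) (pow_mem (X_mem_supported.2 hv) _)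

lemma h₂_mem_supported (j : Fin r ⊕ Fin n) :
    P.h₂ j ∈ supported ℝ (Set.range (Var.y (n := n))) := by
  rcases j with j | j
  · rw [h₂, Sum.elim_inl, inY, mem_supported]
    intro v hv
    obtain ⟨i, -, rfl⟩ := Finset.mem_image.1 (vars_rename Var.y (P.g j) hv)
    exact ⟨i, rfl⟩
  · exact one_sub_X_sq_mem_supported ⟨j, rfl⟩

lemma h₃_mem_supported (j : Fin n) : h₃ n j ∈ supported ℝ (Set.range (Var.x (n := n))) :=
  one_sub_X_sq_mem_supported ⟨j, rfl⟩

lemma h₄_mem_supported (j : Unit) : h₄ n fl fu j ∈ supported ℝ ({Var.z} : Set (Var n)) := by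
  have hX : (X Var.z : MvPolynomial (Var n) ℝ) ∈ supported ℝ ({Var.z} : Set (Var n)) :=
    X_mem_supported.2 (Set.mem_singleton _)
  exact sub_mem (Subalgebra.algebraMap_mem _ _) (pow_mem hX _)

lemma ball_eq_h₁_inr (fl fu : ℝ) :
    (C (2 * (n : ℝ) + (fu - fl) ^ 2) - ∑ v : Var n, X v ^ 2 : MvPolynomial (Var n) ℝ)
      = P.h₁ fl fu (Sum.inr ()) := by
  rw [h₁, Sum.elim_inr, Fintype.sum_sum_type, Fintype.sum_sum_type, Finset.sum_add_distrib,
    ← add_assoc, sub_add_eq_sub_sub,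
    Fintype.sum_unique (fun u : Unit => (X (Sum.inr (Sum.inr u)) : MvPolynomial (Var n) ℝ) ^ 2)]

variable {P}

/-- Feasible polynomials bound `z` from above on `K`. -/
lemma SparseFeasible.le_eval (hcube : P.feasibleSet ⊆ cube n) {k : ℕ}
    {φ : MvPolynomial (Fin n) ℝ} (hφ : P.SparseFeasible fl fu k φ) {x y : Fin n → ℝ} {z : ℝ}
    (hw : (x, y, z) ∈ P.setK fl fu) : z ≤ eval x φ := by
  obtain ⟨-, f₁, hf₁, f₂, hf₂, f₃, hf₃, f₄, hf₄, he⟩ := hφ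
  obtain ⟨h1, hx, hy, hz⟩ := hw
  have hx' := mem_cube_iff_one_sub_sq.1 hx
  have hy' := mem_cube_iff_one_sub_sq.1 (hcube hy)
  have hz' : 0 ≤ (fu - fl) ^ 2 - z ^ 2 := by nlinarith [hz.1, hz.2]
  have e₁ := eval_nonneg_of_mem_truncQuadModule hf₁ (x := Var.point x y z) (by
    rintro (i | i)
    · rw [eval_h₁_inl]; exact h1 i
    · rw [eval_h₁_inr]
      exact add_nonneg (Finset.sum_nonneg fun j _ => add_nonneg (hx' j) (hy' j)) hz')
  have e₂ := eval_nonneg_of_mem_truncQuadModule hf₂ (x := Var.point x y z) (by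
    rintro (i | i)
    · rw [eval_h₂_inl]; exact hy i
    · rw [eval_h₂_inr]; exact hy' i)
  have e₃ := eval_nonneg_of_mem_truncQuadModule hf₃ (x := Var.point x y z)
    (fun j => by rw [eval_h₃]; exact hx' j)
  have e₄ := eval_nonneg_of_mem_truncQuadModule hf₄ (x := Var.point x y z)
    (fun j => by rw [eval_h₄]; exact hz')
  have := congrArg (eval (Var.point x y z)) he
  simp only [map_sub, map_add, Var.eval_inX, eval_X] at this
  change eval x φ - z = _ at this
  linarith

/-- A polynomial `φ` with `z < φ(x)` on `K` is feasible for all large relaxation orders. -/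
theorem sparseFeasible_of_forall_lt (hM : fl ≤ fu) {φ : MvPolynomial (Fin n) ℝ}
    (hφ : ∀ x y z, (x, y, z) ∈ P.setK fl fu → z < eval x φ) :
    ∃ k₀, ∀ k, k₀ ≤ k → P.SparseFeasible fl fu k φ := by
  set ρ : ℝ := 2 * n + (fu - fl) ^ 2 with hρ
  have hρ0 : 0 ≤ ρ := by positivity
  -- The half-width `ρ + 1` is positive even for `ρ = 0`, and `ρ ≤ (ρ + 1)²`, so `B` contains the
  -- ball of squared radius `ρ`.
  set B : Set (Var n → ℝ) := Set.Icc (fun _ => -(ρ + 1)) (fun _ => ρ + 1)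
  have hB : IsCompact B := isCompact_Icc
  have hcl : ∀ {ι : Type} (h : ι → MvPolynomial (Var n) ℝ),
      IsClosed {w : Var n → ℝ | ∀ j, 0 ≤ eval w (h j)} := fun h => by
    simp only [Set.ofPred_forall]
    exact isClosed_iInter fun j => isClosed_le continuous_const (continuous_eval _)
  -- Block 1 is released on the part of `B` cut out by blocks 2, 3 and 4; then each of these is
  -- released in turn, until positivity holds on all of `B`.
  obtain ⟨d₁, u₁, hu₁, pos₁⟩ := exists_mem_truncQuadModule_pos_sub
    (P.h₁_mem_supported (fl := fl) (fu := fu))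
    (((hB.inter_right (hcl (h₄ n fl fu))).inter_right (hcl (h₃ n))).inter_right (hcl P.h₂))
    (inX φ - X Var.z) (by
      rintro w ⟨⟨⟨-, h4⟩, h3⟩, h2⟩ h1
      rw [Var.eq_point w] at h1 h2 h3 h4 ⊢
      set x : Fin n → ℝ := fun j => w (Var.x j)
      set y : Fin n → ℝ := fun j => w (Var.y j)
      set z : ℝ := w Var.z
      have hz : z ^ 2 ≤ (fu - fl) ^ 2 := by
        have := h4 ()
        rw [eval_h₄] at this; linarith
      have key := hφ x y z ⟨fun i => by
          have := h1 (Sum.inl i)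
          rwa [eval_h₁_inl] at this,
        mem_cube_iff_one_sub_sq.2 fun j => by
          have := h3 j
          rwa [eval_h₃] at this,
        fun j => by
          have := h2 (Sum.inl j)
          rwa [eval_h₂_inl] at this,
        by
          have := abs_le_of_sq_le_sq' hz (by linarith)
          exact ⟨by linarith [this.1], this.2⟩⟩
      rw [map_sub, Var.eval_inX, eval_X]
      change 0 < eval x φ - z
      linarith)
  obtain ⟨d₂, u₂, hu₂, pos₂⟩ := exists_mem_truncQuadModule_pos_sub P.h₂_mem_supported
    ((hB.inter_right (hcl (h₄ n fl fu))).inter_right (hcl (h₃ n))) _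
    (fun w hw h => pos₁ w ⟨hw, h⟩)
  obtain ⟨d₃, u₃, hu₃, pos₃⟩ := exists_mem_truncQuadModule_pos_sub h₃_mem_supported
    (hB.inter_right (hcl (h₄ n fl fu))) _ (fun w hw h => pos₂ w ⟨hw, h⟩)
  obtain ⟨d₄, u₄, hu₄, pos₄⟩ := exists_mem_truncQuadModule_pos_sub h₄_mem_supported hB _
    (fun w hw h => pos₃ w ⟨hw, h⟩)
  obtain ⟨s₀, s₁, hs₀, hs₁, he⟩ := mem_preorderingOf.1 <| mem_preorderingOf_ball_of_pos_on_box
    (ρ := ρ) (R := ρ + 1) (by linarith) (by nlinarith) _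
    (fun w hw => pos₄ w ⟨fun j => (hw j).1, fun j => (hw j).2⟩)
  rw [P.ball_eq_h₁_inr fl fu] at he
  -- The final remainder involves all the variables and joins `u₁` in block 1, where the ball
  -- polynomial is a constraint.
  obtain ⟨d₅, hu₅⟩ := sos_add_mul_mem_truncQuadModule (h := P.h₁ fl fu) hs₀.isSOSIn_univ
    hs₁.isSOSIn_univ (Sum.inr ())
  rw [← he] at hu₅
  refine ⟨φ.totalDegree + d₁ + d₂ + d₃ + d₄ + d₅, fun k hk => ⟨by omega, _,
    add_mem_truncQuadModule (truncQuadModule_mono (by omega) hu₁)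
      (truncQuadModule_mono (by omega) hu₅),
    u₂, truncQuadModule_mono (by omega) hu₂, u₃, truncQuadModule_mono (by omega) hu₃,
    u₄, truncQuadModule_mono (by omega) hu₄, ?_⟩⟩
  ring

end VROP

/-! ### Approximating `ψ̃` from above in `L¹` -/

lemma exists_mvPolynomial_near {σ : Type*} {K : Set (σ → ℝ)} (hK : IsCompact K)
    {g : (σ → ℝ) → ℝ} (hg : Continuous g) {δ : ℝ} (hδ : 0 < δ) :
    ∃ φ : MvPolynomial σ ℝ, ∀ x ∈ K, |eval x φ - g x| < δ := by
  let ev : MvPolynomial σ ℝ →ₐ[ℝ] C(σ → ℝ, ℝ) :=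
    aeval fun i => (⟨fun x => x i, continuous_apply i⟩ : C(σ → ℝ, ℝ))
  have hev : ∀ φ x, ev φ x = eval x φ := by
    intro φ x
    have : (ContinuousMap.evalAlgHom ℝ ℝ x).comp ev = aeval x :=
      MvPolynomial.algHom_ext fun i => by
        simp only [ev, AlgHom.comp_apply, aeval_X]
        rfl
    have := DFunLike.congr_fun this φ
    simpa [aeval_eq_eval] using this
  have hsep : ev.range.SeparatesPoints := by
    intro x y hxy
    obtain ⟨i, hi⟩ := Function.ne_iff.1 hxy
    exact ⟨_, ⟨ev (X i), ⟨X i, rfl⟩, rfl⟩, by simpa [hev] using hi⟩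
  obtain ⟨_, ⟨φ, rfl⟩, h⟩ :=
    ContinuousMap.exists_mem_subalgebra_near_continuous_of_isCompact_of_separatesPoints hsep
      ⟨g, hg⟩ hK hδ
  refine ⟨φ, fun x hx => ?_⟩
  have := h x hx
  rw [← hev]
  exact this

lemma isCompact_cube (n : ℕ) : IsCompact (cube n) := isCompact_Icc

lemma zero_mem_cube (n : ℕ) : (0 : Fin n → ℝ) ∈ cube n :=
  ⟨fun _ => by simp, fun _ => by simp⟩

instance isFiniteMeasure_cubeMeasure (n : ℕ) : IsFiniteMeasure (cubeMeasure n) := by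
  have : IsFiniteMeasure (volume.restrict (cube n)) :=
    isFiniteMeasure_restrict.2 (isCompact_cube n).measure_lt_top.ne
  exact Measure.smul_finite _ (ENNReal.inv_ne_top.2 (by simp))

lemma ae_mem_cube (n : ℕ) : ∀ᵐ x ∂(cubeMeasure n), x ∈ cube n :=
  Measure.ae_smul_measure (ae_restrict_mem (isCompact_cube n).measurableSet) _

lemma Continuous.integrable_cubeMeasure {n : ℕ} {f : (Fin n → ℝ) → ℝ} (hf : Continuous f) :
    Integrable f (cubeMeasure n) := by
  obtain ⟨b, hb⟩ := (isCompact_cube n).exists_bound_of_continuousOn hf.continuousOn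
  exact Integrable.of_bound hf.aestronglyMeasurable b ((ae_mem_cube n).mono hb)

namespace VROP

variable {n m r : ℕ} {P : VROP n m r} {fl fu : ℝ}

lemma isCompact_setK (hcpt : IsCompact P.feasibleSet) : IsCompact (P.setK fl fu) := by
  have hcl : IsClosed {w : (Fin n → ℝ) × (Fin n → ℝ) × ℝ | ∀ i, 0 ≤
      eval w.1 (P.p i) * eval w.2.1 (P.q i) - eval w.2.1 (P.p i) * eval w.1 (P.q i)
        - w.2.2 * eval w.1 (P.q i) * eval w.2.1 (P.q i)} := by
    simp only [Set.ofPred_forall]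
    refine isClosed_iInter fun i => isClosed_le continuous_const ?_
    have c1 : ∀ f : MvPolynomial (Fin n) ℝ,
        Continuous fun w : (Fin n → ℝ) × (Fin n → ℝ) × ℝ => eval w.1 f :=
      fun f => (continuous_eval f).comp continuous_fst
    have c2 : ∀ f : MvPolynomial (Fin n) ℝ,
        Continuous fun w : (Fin n → ℝ) × (Fin n → ℝ) × ℝ => eval w.2.1 f :=
      fun f => (continuous_eval f).comp (continuous_fst.comp continuous_snd)
    have c3 : Continuous fun w : (Fin n → ℝ) × (Fin n → ℝ) × ℝ => w.2.2 :=
      continuous_snd.comp continuous_snd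
    exact (((c1 _).mul (c2 _)).sub ((c2 _).mul (c1 _))).sub ((c3.mul (c1 _)).mul (c2 _))
  exact ((isCompact_cube n).prod (hcpt.prod isCompact_Icc)).inter_left hcl

lemma bddAbove_snd_image_fibreK (x : Fin n → ℝ) :
    BddAbove (Prod.snd '' P.fibreK fl fu x) := by
  refine ⟨fu - fl, ?_⟩
  rintro _ ⟨w, hw, rfl⟩
  exact hw.2.2.2.2

lemma le_psiTilde {x y : Fin n → ℝ} {z : ℝ} (h : (x, y, z) ∈ P.setK fl fu) :
    z ≤ P.psiTilde fl fu x :=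
  le_csSup (bddAbove_snd_image_fibreK x) ⟨(y, z), h, rfl⟩

lemma psiTilde_le {x : Fin n → ℝ} (hx : (P.fibreK fl fu x).Nonempty) {c : ℝ}
    (h : ∀ y z, (x, y, z) ∈ P.setK fl fu → z ≤ c) : P.psiTilde fl fu x ≤ c := by
  refine csSup_le (hx.image _) ?_
  rintro _ ⟨⟨y, z⟩, hw, rfl⟩
  exact h y z hw

/-- The Lipschitz regularizations of `ψ̃`: the largest value of `z - j |x - x'|` over the points
`(x', y, z)` of `K`. -/
noncomputable def psiReg (P : VROP n m r) (fl fu : ℝ) (j : ℕ) (x : Fin n → ℝ) : ℝ :=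
  sSup ((fun w : (Fin n → ℝ) × (Fin n → ℝ) × ℝ => w.2.2 - j * dist x w.1) '' P.setK fl fu)

/-- The supremum runs over the fixed compact set `K`, unlike that of `ψ̃`, whose fibre varies with
`x`. -/
lemma continuous_psiReg (hcpt : IsCompact P.feasibleSet) (j : ℕ) :
    Continuous (P.psiReg fl fu j) := by
  refine (isCompact_setK hcpt).continuous_sSup
    (f := fun (x : Fin n → ℝ) (w : (Fin n → ℝ) × (Fin n → ℝ) × ℝ) => w.2.2 - j * dist x w.1) ?_
  change Continuous fun v : (Fin n → ℝ) × ((Fin n → ℝ) × (Fin n → ℝ) × ℝ) =>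
    v.2.2.2 - j * dist v.1 v.2.1
  fun_prop

lemma le_psiReg {x y : Fin n → ℝ} {z : ℝ} (h : (x, y, z) ∈ P.setK fl fu) (j : ℕ) :
    z ≤ P.psiReg fl fu j x := by
  refine le_csSup ⟨fu - fl, ?_⟩ ⟨(x, y, z), h, by simp⟩
  rintro _ ⟨w, hw, rfl⟩
  have := hw.2.2.2.2
  have : 0 ≤ (j : ℝ) * dist x w.1 := by positivity
  simp only
  linarith

lemma psiReg_le {x : Fin n → ℝ} (hx : (P.fibreK fl fu x).Nonempty) {j : ℕ} {c : ℝ}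
    (h : ∀ x' y z, (x', y, z) ∈ P.setK fl fu → z - j * dist x x' ≤ c) :
    P.psiReg fl fu j x ≤ c := by
  obtain ⟨w, hw⟩ := hx
  refine csSup_le (Set.Nonempty.image _ ⟨_, hw⟩) ?_
  rintro _ ⟨⟨x', y, z⟩, hw, rfl⟩
  exact h x' y z hw

/-- Taking `x' = x` gives `psiReg ≥ ψ̃`. For `c' > ψ̃(x)`, the points of `K` with `z ≥ c'` project
to a compact set missing `x`, hence at distance at least some `δ > 0`; for large `j` the penalty `j
δ` brings their contribution below `c'`. -/
lemma tendsto_psiReg (hcpt : IsCompact P.feasibleSet) {x : Fin n → ℝ}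
    (hx : (P.fibreK fl fu x).Nonempty) :
    Tendsto (fun j => P.psiReg fl fu j x) atTop (𝓝 (P.psiTilde fl fu x)) := by
  refine tendsto_order.2 ⟨fun a ha => Eventually.of_forall fun j => ha.trans_le
    (psiTilde_le hx fun y z h => le_psiReg h j), fun c hc => ?_⟩
  obtain ⟨c', hc1, hc2⟩ := exists_between hc
  have hS : IsCompact (Prod.fst '' (P.setK fl fu ∩ {w | c' ≤ w.2.2})) :=
    ((isCompact_setK hcpt).inter_right
      (isClosed_le continuous_const (continuous_snd.comp continuous_snd))).image continuous_fst
  have hxS : x ∉ Prod.fst '' (P.setK fl fu ∩ {w | c' ≤ w.2.2}) := by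
    rintro ⟨⟨x', y, z⟩, ⟨hw, hz⟩, rfl⟩
    exact absurd (le_psiTilde hw) (not_le.2 (hc1.trans_le hz))
  obtain ⟨δ, hδ, hball⟩ := Metric.isOpen_iff.1 hS.isClosed.isOpen_compl x hxS
  obtain ⟨N, hN⟩ := exists_nat_gt ((fu - fl - c') / δ)
  filter_upwards [eventually_ge_atTop N] with j hj
  refine (psiReg_le hx fun x' y z hw => ?_).trans_lt hc2
  rcases le_or_gt c' z with hz | hz
  · have hd : δ ≤ dist x x' := by
      by_contra hlt
      rw [dist_comm] at hlt
      exact hball (Metric.mem_ball.2 (not_le.1 hlt)) ⟨(x', y, z), ⟨hw, hz⟩, rfl⟩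
    have hzM : z ≤ fu - fl := hw.2.2.2.2
    rw [div_lt_iff₀ hδ] at hN
    have hj' : (N : ℝ) ≤ j := by exact_mod_cast hj
    have h1 : (N : ℝ) * δ ≤ j * dist x x' :=
      mul_le_mul hj' hd hδ.le (Nat.cast_nonneg _)
    linarith
  · have : 0 ≤ (j : ℝ) * dist x x' := by positivity
    linarith

lemma abs_psiReg_le {x : Fin n → ℝ} (hx : (P.fibreK fl fu x).Nonempty) (j : ℕ) :
    |P.psiReg fl fu j x| ≤ fu - fl := by
  refine abs_le.2 ⟨?_, psiReg_le hx fun x' y z hw => ?_⟩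
  · obtain ⟨⟨y, z⟩, hw⟩ := hx
    have h1 : fl - fu ≤ z := hw.2.2.2.1
    linarith [le_psiReg hw j]
  · have : z ≤ fu - fl := hw.2.2.2.2
    have : 0 ≤ (j : ℝ) * dist x x' := by positivity
    linarith

variable (hcpt : IsCompact P.feasibleSet) (hK : ∀ x ∈ cube n, (P.fibreK fl fu x).Nonempty)

include hcpt hK in
-- Measurability comes from being an almost everywhere limit of continuous functions, and the bound
-- `fu - fl` passes to the limit.
lemma integrable_psiTilde : Integrable (P.psiTilde fl fu) (cubeMeasure n) := by
  have hmeas : AEStronglyMeasurable (P.psiTilde fl fu) (cubeMeasure n) :=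
    aestronglyMeasurable_of_tendsto_ae atTop
      (fun j => (continuous_psiReg hcpt j).aestronglyMeasurable)
      ((ae_mem_cube n).mono fun x hx => tendsto_psiReg hcpt (hK x hx))
  refine Integrable.of_bound hmeas (fu - fl) ((ae_mem_cube n).mono fun x hx => ?_)
  exact le_of_tendsto (tendsto_psiReg hcpt (hK x hx)).abs
    (Eventually.of_forall fun j => abs_psiReg_le (hK x hx) j)

include hcpt hK in
lemma tendsto_integral_psiReg :
    Tendsto (fun j => ∫ x, P.psiReg fl fu j x ∂(cubeMeasure n)) atTop
      (𝓝 (∫ x, P.psiTilde fl fu x ∂(cubeMeasure n))) :=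
  tendsto_integral_of_dominated_convergence (fun _ => fu - fl)
    (fun j => (continuous_psiReg hcpt j).aestronglyMeasurable) (integrable_const _)
    (fun j => (ae_mem_cube n).mono fun x hx => abs_psiReg_le (hK x hx) j)
    ((ae_mem_cube n).mono fun x hx => tendsto_psiReg hcpt (hK x hx))

include hcpt hK in
/-- `ψ̃` can be approximated from above in `L¹` by polynomials. -/
lemma exists_mvPolynomial_integral_lt {c : ℝ}
    (hc : ∫ x, P.psiTilde fl fu x ∂(cubeMeasure n) < c) :
    ∃ φ : MvPolynomial (Fin n) ℝ, (∀ x y z, (x, y, z) ∈ P.setK fl fu → z < eval x φ) ∧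
      ∫ x, eval x φ ∂(cubeMeasure n) < c := by
  obtain ⟨j, hj⟩ := ((tendsto_order.1 (tendsto_integral_psiReg hcpt hK)).2 c hc).exists
  set v := (cubeMeasure n).real Set.univ
  have hv : 0 ≤ v := measureReal_nonneg
  obtain ⟨δ, hδ, hδc⟩ : ∃ δ : ℝ, 0 < δ ∧
      ∫ x, P.psiReg fl fu j x ∂(cubeMeasure n) + 2 * δ * v < c := by
    set e := c - ∫ x, P.psiReg fl fu j x ∂(cubeMeasure n)
    have he : 0 < e := sub_pos.2 hj
    refine ⟨e / (2 * (v + 1)), by positivity, ?_⟩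
    have : 2 * (e / (2 * (v + 1))) * v < e := by
      have : 2 * (e / (2 * (v + 1))) * v = e * (v / (v + 1)) := by field_simp
      rw [this]
      exact mul_lt_of_lt_one_right he (by rw [div_lt_one (by positivity)]; linarith)
    linarith [show e = c - ∫ x, P.psiReg fl fu j x ∂(cubeMeasure n) from rfl]
  -- Approximating `psiReg + δ` within `δ` puts `φ` strictly between `psiReg` and `psiReg + 2 δ` on
  -- the cube.
  obtain ⟨φ, hφ⟩ := exists_mvPolynomial_near (isCompact_cube n)
    (g := fun x => P.psiReg fl fu j x + δ) ((continuous_psiReg hcpt j).add continuous_const) hδ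
  refine ⟨φ, fun x y z hw => ?_, lt_of_le_of_lt ?_ hδc⟩
  · have := (abs_lt.1 (hφ x hw.2.1)).1
    linarith [le_psiReg hw j]
  · have hi := (continuous_psiReg (fl := fl) (fu := fu) hcpt j).integrable_cubeMeasure
    calc ∫ x, eval x φ ∂(cubeMeasure n)
        ≤ ∫ x, (P.psiReg fl fu j x + 2 * δ) ∂(cubeMeasure n) := by
          refine integral_mono_ae (continuous_eval φ).integrable_cubeMeasure
            (hi.add (integrable_const _)) ((ae_mem_cube n).mono fun x hx => ?_)
          have := (abs_lt.1 (hφ x hx)).2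
          simp only
          linarith
      _ = ∫ x, P.psiReg fl fu j x ∂(cubeMeasure n) + 2 * δ * v := by
          rw [integral_add hi (integrable_const _), integral_const, smul_eq_mul, mul_comm v]

/-! ### Convergence of the relaxation values and of near-minimizers -/

variable (hcube : P.feasibleSet ⊆ cube n)

include hcube hK in
lemma SparseFeasible.psiTilde_le {k : ℕ} {φ : MvPolynomial (Fin n) ℝ}
    (hφ : P.SparseFeasible fl fu k φ) {x : Fin n → ℝ} (hx : x ∈ cube n) :
    P.psiTilde fl fu x ≤ eval x φ :=
  VROP.psiTilde_le (hK x hx) fun _ _ hw => hφ.le_eval hcube hw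

include hcpt hcube hK in
lemma SparseFeasible.integral_psiTilde_le {k : ℕ} {φ : MvPolynomial (Fin n) ℝ}
    (hφ : P.SparseFeasible fl fu k φ) :
    ∫ x, P.psiTilde fl fu x ∂(cubeMeasure n) ≤ ∫ x, eval x φ ∂(cubeMeasure n) :=
  integral_mono_ae (integrable_psiTilde hcpt hK) (continuous_eval φ).integrable_cubeMeasure
    ((ae_mem_cube n).mono fun _ hx => hφ.psiTilde_le hK hcube hx)

include hcpt hcube hK in
lemma tendsto_sparseValue (hM : fl ≤ fu) :
    Tendsto (P.sparseValue fl fu) atTop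
      (𝓝 ((∫ x, P.psiTilde fl fu x ∂(cubeMeasure n) : ℝ) : EReal)) := by
  refine tendsto_order.2 ⟨fun a ha => Eventually.of_forall fun k => ha.trans_le ?_,
    fun c hc => ?_⟩
  · exact le_iInf₂ fun φ hφ => EReal.coe_le_coe_iff.2 (hφ.integral_psiTilde_le hcpt hK hcube)
  · obtain ⟨c', hc1, hc2⟩ := EReal.exists_between_coe_real hc
    obtain ⟨φ, hφ, hφc⟩ := exists_mvPolynomial_integral_lt hcpt hK (EReal.coe_lt_coe_iff.1 hc1)
    obtain ⟨k₀, hk₀⟩ := sparseFeasible_of_forall_lt hM hφ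
    filter_upwards [eventually_ge_atTop k₀] with k hk
    exact ((iInf₂_le φ (hk₀ k hk)).trans (EReal.coe_le_coe_iff.2 hφc.le)).trans_lt hc2

end VROP

theorem theorem4p6 {n m r : ℕ} (hm : 0 < m) (P : VROP n m r)
    (hne : P.feasibleSet.Nonempty) (hcpt : IsCompact P.feasibleSet)
    (hq : ∀ i, ∀ x ∈ P.feasibleSet, 0 < eval x (P.q i))
    (hcube : P.feasibleSet ⊆ cube n)
    (a b : Fin m → ℝ) (ha : P.IsCertLower a) (hb : P.IsCertUpper b)
    (fl fu : ℝ) (hfl : fl = ⨅ i, a i) (hfu : fu = ⨆ i, b i)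
    -- `ψ̃` is a well-defined real function on `Δ`
    (hK : ∀ x ∈ cube n, (P.fibreK fl fu x).Nonempty) :
    Integrable (P.psiTilde fl fu) (cubeMeasure n) ∧
    Tendsto (P.sparseValue fl fu) atTop
      (𝓝 ((∫ x, P.psiTilde fl fu x ∂(cubeMeasure n) : ℝ) : EReal)) ∧
    ∀ (ε : ℕ → ℝ) (ψ : ℕ → MvPolynomial (Fin n) ℝ), Tendsto ε atTop (𝓝 0) →
      (∀ k, P.minOrder fl fu ≤ k → P.SparseFeasible fl fu k (ψ k) ∧
        ((∫ x, eval x (ψ k) ∂(cubeMeasure n) : ℝ) : EReal) ≤ P.sparseValue fl fu k + (ε k : ℝ)) →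
      (∀ k, P.minOrder fl fu ≤ k → ∀ x ∈ cube n, P.psiTilde fl fu x ≤ eval x (ψ k)) ∧
      Tendsto (fun k => ∫ x, |eval x (ψ k) - P.psiTilde fl fu x| ∂(cubeMeasure n))
        atTop (𝓝 0) := by
  -- The fibre over `0` is nonempty, so the interval `[fl - fu, fu - fl]` is too.
  have hM : fl ≤ fu := by
    obtain ⟨w, hw⟩ := hK 0 (zero_mem_cube n)
    have h1 : fl - fu ≤ w.2 := hw.2.2.2.1
    have h2 : w.2 ≤ fu - fl := hw.2.2.2.2
    linarith
  have hint := VROP.integrable_psiTilde hcpt hK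
  have hlim := VROP.tendsto_sparseValue hcpt hK hcube hM
  refine ⟨hint, hlim, fun ε ψ hε hψ => ?_⟩
  have hge : ∀ k, P.minOrder fl fu ≤ k → ∀ x ∈ cube n, P.psiTilde fl fu x ≤ eval x (ψ k) :=
    fun k hk x hx => (hψ k hk).1.psiTilde_le hK hcube hx
  refine ⟨hge, ?_⟩
  set L := ∫ x, P.psiTilde fl fu x ∂(cubeMeasure n)
  refine tendsto_order.2 ⟨fun c hc => Eventually.of_forall fun k => hc.trans_le
    (integral_nonneg fun x => abs_nonneg _), fun c hc => ?_⟩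
  have hev := (tendsto_order.1 hlim).2 ((L + c / 2 : ℝ) : EReal)
    (EReal.coe_lt_coe_iff.2 (by linarith))
  filter_upwards [hev, (tendsto_order.1 hε).2 (c / 2) (by linarith),
    eventually_ge_atTop (P.minOrder fl fu)] with k hk1 hk2 hk3
  have h1 : ∫ x, eval x (ψ k) ∂(cubeMeasure n) ≤ L + c / 2 + ε k := by
    have := (hψ k hk3).2.trans (add_le_add_left hk1.le ((ε k : ℝ) : EReal))
    rw [← EReal.coe_add] at this
    exact EReal.coe_le_coe_iff.1 this
  -- Domination `ψ k ≥ ψ̃` on the cube turns the `L¹` distance into a difference of integrals, which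
  -- is below `c / 2 + c / 2`.
  have h2 : ∫ x, |eval x (ψ k) - P.psiTilde fl fu x| ∂(cubeMeasure n)
      = ∫ x, eval x (ψ k) ∂(cubeMeasure n) - L := by
    rw [← integral_sub (continuous_eval (ψ k)).integrable_cubeMeasure hint]
    refine integral_congr_ae ((ae_mem_cube n).mono fun x hx => ?_)
    exact abs_of_nonneg (sub_nonneg.2 (hge k hk3 x hx))
  rw [h2]
  linarith
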